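/- Let $d\ge 1$ and let $\Gamma$ be a connected undirected graph (loops and multiple edges are allowed) equipped with a free action of $\mathbb{Z}^d$ by graph automorphisms (free meaning that no nonzero element of $\mathbb{Z}^d$ fixes a vertex) such that the quotient graph $\Gamma/\mathbb{Z}^d$ is finite, i.e. there are only finitely many $\mathbb{Z}^d$-orbits of vertices and finitely many $\mathbb{Z}^d$-orbits of edges. Let $X$ be the vertex set of $\Gamma$ with the shortest-path metric $d_\Gamma$, and write $B(x_0,r)=\{x\in X : d_\Gamma(x,x_0)\le r\}$. Then $(X,d_\Gamma)$ is a countably infinite metric space in which every ball is finite, and it satisfies condition (C): for every $x_0\in X$, the set of distances $\{d_\Gamma(x,x_0): x\in X\}$ can be ordered as a strictly increasing sequence $(r_k)_{k\in\mathbb{N}}$, and $$\lim_{k\to\infty}\frac{|B(x_0,r_{k+1})|}{|B(x_0,r_k)|}=1 .$$ -/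

import Mathlib

/-- The shortest-path metric of a connected graph, as a metric space structure on its vertices. For
a multigraph, use it with the simple graph `Graph.toSimpleGraph`, which has the same vertices and
joins distinct vertices that are joined by some edge: loops and parallel edges do not affect
lengths of shortest paths. -/
noncomputable abbrev SimpleGraph.Connected.pathMetricSpace {V : Type*} {G : SimpleGraph V}
    (hG : G.Connected) : MetricSpace V where
  dist x y := (G.dist x y : ℝ)
  dist_self x := by simp
  dist_comm x y := by simp [G.dist_comm (u := x) (v := y)]
  dist_triangle x y z := by exact_mod_cast hG.dist_triangle
  eq_of_dist_eq_zero h := hG.dist_eq_zero_iff.mp (by exact_mod_cast h)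

/-- Condition (C) at the base point `x₀`: the set of values of `dist · x₀` is the range of a
strictly increasing sequence `r₀ < r₁ < ⋯` (such a sequence is unique), and
`|B(x₀, r_{k+1})| / |B(x₀, r_k)| → 1`, where `B` denotes closed balls. -/
def ConditionCAt {X : Type*} [MetricSpace X] (x₀ : X) : Prop :=
  ∃ r : ℕ → ℝ, StrictMono r ∧ Set.range r = Set.range (fun x : X => dist x x₀) ∧
    Filter.Tendsto
      (fun k => ((Metric.closedBall x₀ (r (k + 1))).ncard : ℝ) /
        ((Metric.closedBall x₀ (r k)).ncard : ℝ))
      Filter.atTop (nhds 1)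

/-- `X` is a countably infinite metric space all of whose balls are finite (in particular it is
discrete), and it satisfies condition (C) at every base point. -/
structure HasPropertyC (X : Type*) [MetricSpace X] : Prop where
  countable : Countable X
  infinite : Infinite X
  finite_closedBall : ∀ (x : X) (R : ℝ), (Metric.closedBall x R).Finite
  conditionC : ∀ x₀ : X, ConditionCAt x₀

/-- The given actions of `ℤ^d` on the vertices and on the edges of the (multi)graph `G` form a free
action on `G` by graph automorphisms, and the quotient graph is finite: there are finitely many
vertex orbits and finitely many edge orbits. Since no nonzero element fixes a vertex and `ℤ^d` is
torsion-free, no nonzero element fixes an edge either. -/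
structure IsFreeCofiniteAction (d : ℕ) {α β : Type*} (G : Graph α β)
    [AddAction (Fin d → ℤ) G.vertexSet] [AddAction (Fin d → ℤ) G.edgeSet] : Prop where
  isLink_vadd : ∀ (a : Fin d → ℤ) (e : G.edgeSet) (x y : G.vertexSet),
    G.IsLink (e : β) (x : α) (y : α) →
      G.IsLink ((a +ᵥ e : G.edgeSet) : β) ((a +ᵥ x : G.vertexSet) : α) ((a +ᵥ y : G.vertexSet) : α)
  free : ∀ (a : Fin d → ℤ) (x : G.vertexSet), a +ᵥ x = x → a = 0
  finite_vertices : Finite (AddAction.orbitRel.Quotient (Fin d → ℤ) G.vertexSet)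
  finite_edges : Finite (AddAction.orbitRel.Quotient (Fin d → ℤ) G.edgeSet)

/-!
Let `N` be the number of vertex orbits. A geodesic of length `n` from `x₀` to `y` splits into `n / N`
pieces of length `N`, and by the pigeonhole principle each piece contains a segment from some `p` to
`g +ᵥ p` with `g` in `ℤ^d`, that is, a closed loop in the quotient graph
(`SimpleGraph.IsPeriodic.exists_loop`). Up to translation there are only finitely many types
`(g, l)` of such loops, where `l ≤ N` is the length, so one type occurs at least `m` times with `m`
of order `n`. As `ℤ^d` is commutative, cutting out `k ≤ m` of these loops leaves a path from `x₀` to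
`-(k • g) +ᵥ y` of length `n - k * l` (`SimpleGraph.IsPeriodic.exists_loop_count`). On the other
hand `-(k • g)` moves `y` by at most `k * l + D` with a constant `D`, because every orbit is coarsely
dense (`SimpleGraph.IsPeriodic.exists_dist_nsmul_vadd_le`), so the new end point lies at distance
between `n - k * l - D` and `n - k * l` from `x₀`.

Therefore `(y, k)` can be recovered from the point `-(k • g) +ᵥ y` of the ball of radius `n`, the
loop type and a defect in `{0, …, D}`. Counting pairs `(y, k)` gives `n * |S(n)| ≤ C * |B(n)|` for
the sphere `S(n)` and the ball `B(n)` (`SimpleGraph.IsPeriodic.exists_mul_ncard_sphere_le`), and so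
`|B(n)| / |B(n + 1)| = 1 - |S(n + 1)| / |B(n + 1)| → 1`. An infinite connected locally finite graph
realizes every natural number as a distance from `x₀`, so the sequence of distances is `r_k = k`.
-/

/-! ### Orbits of additive actions -/

theorem AddAction.vadd_left_injective_of_free {A X : Type*} [AddCommGroup A] [AddAction A X]
    (hfree : ∀ (a : A) (x : X), a +ᵥ x = x → a = 0) (x : X) :
    Function.Injective fun a : A => a +ᵥ x := fun a b hab => by
  have : (-b + a) +ᵥ x = x := by
    rw [add_vadd, show a +ᵥ x = b +ᵥ x from hab, neg_vadd_vadd]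
  exact (neg_add_eq_zero.mp (hfree _ _ this)).symm

theorem AddAction.exists_eq_vadd_out (A : Type*) {X : Type*} [AddCommGroup A] [AddAction A X]
    (x : X) : ∃ (q : AddAction.orbitRel.Quotient A X) (a : A), x = a +ᵥ Quotient.out q := by
  obtain ⟨a, ha⟩ := (AddAction.orbitRel_apply.mp
    (Setoid.symm' _ (Quotient.mk_out (s := AddAction.orbitRel A X) x)))
  exact ⟨_, a, ha.symm⟩

namespace SimpleGraph

variable {V A : Type*} [AddCommGroup A] [AddAction A V]

/-- `H` is a connected locally finite graph, and the action of `A` on its vertices is free, has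
finitely many orbits and preserves adjacency. -/
structure IsPeriodic (A : Type*) {V : Type*} [AddCommGroup A] [AddAction A V]
    (H : SimpleGraph V) : Prop where
  connected : H.Connected
  adj_vadd : ∀ (a : A) {x y : V}, H.Adj x y → H.Adj (a +ᵥ x) (a +ᵥ y)
  free : ∀ (a : A) (x : V), a +ᵥ x = x → a = 0
  finite_orbits : Finite (AddAction.orbitRel.Quotient A V)
  finite_neighborSet : ∀ x : V, (H.neighborSet x).Finite

variable {H : SimpleGraph V}

/-! ### Geodesics and balls in a locally finite graph -/

theorem Connected.exists_dist_eq_add {V : Type*} {H : SimpleGraph V} (h : H.Connected) {x y : V}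
    {m : ℕ} (hm : m ≤ H.dist x y) : ∃ z, H.dist x z = m ∧ m + H.dist z y = H.dist x y := by
  obtain ⟨p, hp⟩ := h.exists_walk_length_eq_dist x y
  have h1 := dist_le (p.take m)
  have h2 := dist_le (p.drop m)
  have h3 := h.dist_triangle (u := x) (v := p.getVert m) (w := y)
  rw [Walk.take_length] at h1
  rw [Walk.drop_length] at h2
  exact ⟨p.getVert m, by omega, by omega⟩

theorem Connected.finite_setOf_dist_le {V : Type*} {H : SimpleGraph V} (h : H.Connected)
    (hf : ∀ x : V, (H.neighborSet x).Finite) (x : V) (n : ℕ) : {y | H.dist x y ≤ n}.Finite := by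
  induction n with
  | zero =>
    refine (Set.finite_singleton x).subset fun y hy => ?_
    exact (h.dist_eq_zero_iff.mp (Nat.le_zero.mp hy)).symm
  | succ n ih =>
    refine (ih.union (ih.biUnion fun z _ => hf z)).subset fun y hy => ?_
    rcases Nat.lt_or_ge n (H.dist x y) with hlt | hle
    · obtain ⟨z, hz, hzy⟩ := h.exists_dist_eq_add hlt.le
      have hy' : H.dist x y ≤ n + 1 := hy
      exact Or.inr (Set.mem_biUnion (x := z) hz.le
        (dist_eq_one_iff_adj.mp (show H.dist z y = 1 by omega)))
    · exact Or.inl hle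

theorem Connected.exists_dist_eq {V : Type*} [Infinite V] {H : SimpleGraph V} (h : H.Connected)
    (hf : ∀ x : V, (H.neighborSet x).Finite) (x : V) (n : ℕ) : ∃ y, H.dist x y = n := by
  obtain ⟨y, hy⟩ := (h.finite_setOf_dist_le hf x n).infinite_compl.nonempty
  obtain ⟨z, hz, -⟩ := h.exists_dist_eq_add (x := x) (y := y) (m := n) (by simp at hy; omega)
  exact ⟨z, hz⟩

namespace IsPeriodic

/-! ### Periodicity of the metric -/

theorem dist_vadd (h : H.IsPeriodic A) (a : A) (x y : V) :
    H.dist (a +ᵥ x) (a +ᵥ y) = H.dist x y := by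
  have key : ∀ (a : A) (x y : V), H.dist (a +ᵥ x) (a +ᵥ y) ≤ H.dist x y := fun a x y => by
    obtain ⟨p, hp⟩ := h.connected.exists_walk_length_eq_dist x y
    let f : H →g H := ⟨fun v => a +ᵥ v, fun hxy => h.adj_vadd a hxy⟩
    rw [← hp, ← Walk.length_map f p]
    exact dist_le (p.map f)
  refine (key a x y).antisymm ?_
  simpa using key (-a) (a +ᵥ x) (a +ᵥ y)

theorem vadd_left_injective (h : H.IsPeriodic A) (x : V) :
    Function.Injective fun a : A => a +ᵥ x :=
  AddAction.vadd_left_injective_of_free h.free x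

/-- Every orbit is coarsely dense. -/
theorem exists_dist_vadd_le (h : H.IsPeriodic A) :
    ∃ D, ∀ x y : V, ∃ a : A, H.dist y (a +ᵥ x) ≤ D := by
  have := h.finite_orbits
  let f : AddAction.orbitRel.Quotient A V × AddAction.orbitRel.Quotient A V → ℕ :=
    fun q => H.dist (Quotient.out q.1) (Quotient.out q.2)
  obtain ⟨D, hD⟩ := (Set.finite_range f).bddAbove
  refine ⟨D, fun x y => ?_⟩
  obtain ⟨q, a, rfl⟩ := AddAction.exists_eq_vadd_out A x
  obtain ⟨q', b, rfl⟩ := AddAction.exists_eq_vadd_out A y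
  refine ⟨b - a, le_of_eq_of_le ?_ (hD ⟨(q', q), rfl⟩)⟩
  rw [vadd_vadd, sub_add_cancel, h.dist_vadd]

theorem finite_setOf_exists_dist_vadd_le (h : H.IsPeriodic A) (n : ℕ) :
    {g : A | ∃ p : V, H.dist p (g +ᵥ p) ≤ n}.Finite := by
  have := h.finite_orbits
  have hfin (x : V) : {g : A | H.dist x (g +ᵥ x) ≤ n}.Finite :=
    (h.connected.finite_setOf_dist_le h.finite_neighborSet x n).preimage
      (h.vadd_left_injective x).injOn
  refine (Set.finite_iUnion fun q : AddAction.orbitRel.Quotient A V =>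
    hfin (Quotient.out q)).subset ?_
  rintro g ⟨p, hp⟩
  obtain ⟨q, a, rfl⟩ := AddAction.exists_eq_vadd_out A p
  refine Set.mem_iUnion.mpr ⟨q, ?_⟩
  rw [vadd_comm, h.dist_vadd] at hp
  exact hp

/-! ### Loops in the quotient graph -/

/-- The types of short loops in the quotient graph: pairs `(g, l)` such that `g` moves some vertex
to distance exactly `l`, where `1 ≤ l ≤ N`. -/
def loopTypes (A : Type*) {V : Type*} [AddCommGroup A] [AddAction A V]
    (H : SimpleGraph V) (N : ℕ) : Set (A × ℕ) :=
  {t | 1 ≤ t.2 ∧ t.2 ≤ N ∧ ∃ p : V, H.dist p (t.1 +ᵥ p) = t.2}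

theorem finite_loopTypes (h : H.IsPeriodic A) (N : ℕ) : (loopTypes A H N).Finite :=
  ((h.finite_setOf_exists_dist_vadd_le N).prod (Set.finite_Iic N)).subset
    fun _ ⟨_, h2, p, hp⟩ => ⟨⟨p, hp.le.trans h2⟩, h2⟩

/-- A geodesic with as many edges as there are orbits visits some orbit twice. -/
theorem exists_loop (h : H.IsPeriodic A) {x z : V}
    (hxz : H.dist x z = Nat.card (AddAction.orbitRel.Quotient A V)) :
    ∃ t ∈ loopTypes A H (Nat.card (AddAction.orbitRel.Quotient A V)), ∃ p : V,
      H.dist x p + t.2 + H.dist (t.1 +ᵥ p) z ≤ H.dist x z := by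
  have := h.finite_orbits
  have := Fintype.ofFinite (AddAction.orbitRel.Quotient A V)
  obtain ⟨w, hw⟩ := h.connected.exists_walk_length_eq_dist x z
  set N := Nat.card (AddAction.orbitRel.Quotient A V) with hN
  obtain ⟨i, j, hij, hq⟩ := Fintype.exists_ne_map_eq_of_card_lt
    (fun i : Fin (N + 1) => (Quotient.mk (AddAction.orbitRel A V) (w.getVert i)))
    (by rw [Fintype.card_fin, hN, Nat.card_eq_fintype_card]; exact Nat.lt_succ_self _)
  wlog hlt : i < j generalizing i j
  · exact this j i hij.symm hq.symm (lt_of_le_of_ne (not_lt.mp hlt) hij.symm)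
  obtain ⟨g, hg⟩ := AddAction.orbitRel_apply.mp (Quotient.exact hq.symm)
  have hg' : g +ᵥ w.getVert i = w.getVert j := hg
  have hlt' : (i : ℕ) < j := hlt
  have hj := j.2
  have h1 := dist_le (w.take i)
  have h2 := dist_le (w.drop j)
  have e : (w.take j).getVert i = w.getVert i := by
    rw [Walk.take_getVert, min_eq_right hlt'.le]
  have h3 : H.dist (w.getVert i) (w.getVert j) ≤ ((w.take j).drop i).length :=
    e ▸ dist_le ((w.take j).drop i)
  rw [Walk.take_length] at h1
  rw [Walk.drop_length] at h2
  rw [Walk.drop_length, Walk.take_length] at h3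
  have t1 := h.connected.dist_triangle (u := x) (v := w.getVert i) (w := z)
  have t2 := h.connected.dist_triangle (u := w.getVert i) (v := w.getVert j) (w := z)
  refine ⟨(g, H.dist (w.getVert i) (w.getVert j)), ⟨?_, ?_, w.getVert i, ?_⟩, w.getVert i, ?_⟩
  · show 1 ≤ H.dist (w.getVert i) (w.getVert j)
    omega
  · show H.dist (w.getVert i) (w.getVert j) ≤ N
    omega
  · show H.dist _ (g +ᵥ _) = _
    rw [hg']
  · show _ + H.dist (w.getVert i) (w.getVert j) + H.dist (g +ᵥ _) z ≤ _
    rw [hg']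
    omega

/-- A geodesic from `x` to `y` contains `q` disjoint loops, `c t` of them of type `t`. Since `A` is
commutative, cutting out `k` loops of the same type `(g, l)` translates the end point by `-k • g`
and shortens the path by `k * l`. -/
theorem exists_loop_count (h : H.IsPeriodic A) {T : Finset (A × ℕ)}
    (hT : ∀ t, t ∈ T ↔ t ∈ loopTypes A H (Nat.card (AddAction.orbitRel.Quotient A V)))
    (q : ℕ) (x y : V) (hq : q * Nat.card (AddAction.orbitRel.Quotient A V) ≤ H.dist x y) :
    ∃ c : A × ℕ → ℕ, ∑ t ∈ T, c t = q ∧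
      ∀ t ∈ T, ∀ k ≤ c t, H.dist x (-(k • t.1) +ᵥ y) + k * t.2 ≤ H.dist x y := by
  classical
  induction q generalizing x with
  | zero =>
    refine ⟨0, by simp, fun t _ k hk => ?_⟩
    obtain rfl : k = 0 := Nat.le_zero.mp hk
    simp
  | succ q ih =>
    rw [Nat.succ_mul] at hq
    obtain ⟨z, hxz, hzy⟩ := h.connected.exists_dist_eq_add (x := x) (y := y)
      (m := Nat.card (AddAction.orbitRel.Quotient A V)) (by omega)
    obtain ⟨c, hc, hck⟩ := ih z (by omega)
    obtain ⟨s, hs, p, hp⟩ := h.exists_loop hxz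
    refine ⟨c + Pi.single s 1, ?_, fun t ht k hk => ?_⟩
    · simp [Finset.sum_add_distrib, hc, (hT s).mpr hs, Finset.sum_pi_single']
    · by_cases hkc : k ≤ c t
      · have h1 := hck t ht k hkc
        have h2 := h.connected.dist_triangle (u := x) (v := z) (w := -(k • t.1) +ᵥ y)
        omega
      · have hts : t = s := by
          by_contra hne
          exact hkc (by simpa [hne] using hk)
        subst hts
        -- Only `k = c t + 1` is left: one copy is cut out of the first piece `x → z`, the other
        -- `c t` copies out of the remaining piece `z → y`.
        obtain rfl : k = c t + 1 := by
          have : k ≤ c t + 1 := by simpa using hk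
          omega
        have h1 := hck t ht (c t) le_rfl
        have h2 := h.connected.dist_triangle (u := x) (v := p) (w := -((c t + 1) • t.1) +ᵥ y)
        have h3 := h.connected.dist_triangle (u := p) (v := -t.1 +ᵥ z)
          (w := -((c t + 1) • t.1) +ᵥ y)
        have h4 : H.dist p (-t.1 +ᵥ z) = H.dist (t.1 +ᵥ p) z := by
          rw [← h.dist_vadd t.1, vadd_neg_vadd]
        have h5 : H.dist (-t.1 +ᵥ z) (-((c t + 1) • t.1) +ᵥ y) =
            H.dist z (-(c t • t.1) +ᵥ y) := by
          rw [← h.dist_vadd t.1, vadd_neg_vadd, vadd_vadd]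
          congr 2
          rw [add_smul, one_smul]
          abel
        rw [Nat.succ_mul]
        omega

/-! ### Spheres are small compared with balls -/

theorem dist_nsmul_vadd_le (h : H.IsPeriodic A) (g : A) (p : V) (k : ℕ) :
    H.dist p (k • g +ᵥ p) ≤ k * H.dist p (g +ᵥ p) := by
  induction k with
  | zero => simp
  | succ k ih =>
    have h1 := h.connected.dist_triangle (u := p) (v := k • g +ᵥ p) (w := (k + 1) • g +ᵥ p)
    rw [add_smul, one_smul, add_vadd, h.dist_vadd] at h1
    rw [add_smul, one_smul, add_vadd, Nat.succ_mul]
    omega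

/-- Translating by `k • g`, where `g` moves some vertex by `l`, moves every vertex by at most
`k * l` up to an error that does not depend on `k`. -/
theorem exists_dist_nsmul_vadd_le (h : H.IsPeriodic A) :
    ∃ D, ∀ (g : A) (p y : V) (k : ℕ),
      H.dist (-(k • g) +ᵥ y) y ≤ k * H.dist p (g +ᵥ p) + D := by
  obtain ⟨D, hD⟩ := h.exists_dist_vadd_le
  refine ⟨2 * D, fun g p y k => ?_⟩
  obtain ⟨a, ha⟩ := hD p y
  have e1 : H.dist (-(k • g) +ᵥ y) y = H.dist y (k • g +ᵥ y) := by
    rw [← h.dist_vadd (k • g), vadd_neg_vadd]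
  have e2 : H.dist (a +ᵥ p) (g +ᵥ a +ᵥ p) = H.dist p (g +ᵥ p) := by
    rw [vadd_comm, h.dist_vadd]
  have h1 := h.dist_nsmul_vadd_le g (a +ᵥ p) k
  have h2 := h.connected.dist_triangle (u := y) (v := a +ᵥ p) (w := k • g +ᵥ y)
  have h3 := h.connected.dist_triangle (u := a +ᵥ p) (v := k • g +ᵥ a +ᵥ p) (w := k • g +ᵥ y)
  have h4 := h.dist_vadd (k • g) (a +ᵥ p) y
  rw [dist_comm (u := a +ᵥ p) (v := y)] at h4
  rw [e2] at h1
  omega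

/-- The sphere of radius `n` has at most `C / n` times as many points as the ball. -/
theorem exists_mul_ncard_sphere_le [Infinite V] (h : H.IsPeriodic A) (x : V) :
    ∃ C, ∀ n : ℕ, n * {y | H.dist x y = n}.ncard ≤ C * {y | H.dist x y ≤ n}.ncard := by
  classical
  set N := Nat.card (AddAction.orbitRel.Quotient A V) with hN
  obtain ⟨D, hD⟩ := h.exists_dist_nsmul_vadd_le
  set T := (h.finite_loopTypes N).toFinset
  have hT : ∀ t, t ∈ T ↔ t ∈ loopTypes A H N := fun t => Set.Finite.mem_toFinset _
  obtain ⟨z, hz⟩ := h.connected.exists_dist_eq h.finite_neighborSet x N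
  obtain ⟨t₀, ht₀, -⟩ := h.exists_loop hz
  have hTpos : 0 < T.card := Finset.card_pos.mpr ⟨t₀, (hT t₀).mpr ht₀⟩
  have hNpos : 0 < N := ht₀.1.trans ht₀.2.1
  refine ⟨N * T.card * (T.card * (D + 1)), fun n => ?_⟩
  have hBfin := h.connected.finite_setOf_dist_le h.finite_neighborSet x n
  have hSfin : {y | H.dist x y = n}.Finite := hBfin.subset fun y hy => le_of_eq hy
  set m := n / N / T.card with hm
  -- For `y` at distance `n`, some loop type occurs at least `m` times on a geodesic to `y`.
  have hex : ∀ y : V, ∃ t : A × ℕ, H.dist x y = n → t ∈ T ∧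
      ∀ k ≤ m, H.dist x (-(k • t.1) +ᵥ y) + k * t.2 ≤ n := by
    intro y
    by_cases hy : H.dist x y = n
    · obtain ⟨c, hc, hck⟩ := h.exists_loop_count hT (n / N) x y
        (by rw [hy]; exact Nat.div_mul_le_self n N)
      obtain ⟨t, ht, hct⟩ := Finset.exists_le_of_sum_le (s := T) (f := fun _ => m) (g := c)
        (Finset.card_pos.mp hTpos) (by
          rw [hc, Finset.sum_const, smul_eq_mul, mul_comm]
          exact Nat.div_mul_le_self _ _)
      exact ⟨t, fun _ => ⟨ht, fun k hk => hy ▸ hck t ht k (hk.trans hct)⟩⟩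
    · exact ⟨t₀, fun h' => absurd h' hy⟩
  choose τ hτ using hex
  have hlow : ∀ y, H.dist x y = n → ∀ k,
      n ≤ H.dist x (-(k • (τ y).1) +ᵥ y) + k * (τ y).2 + D := by
    intro y hy k
    obtain ⟨_, _, p, hp⟩ := (hT _).mp (hτ y hy).1
    have h1 := hD (τ y).1 p y k
    have h2 := h.connected.dist_triangle (u := x) (v := -(k • (τ y).1) +ᵥ y) (w := y)
    rw [hp] at h1
    omega
  -- The translate `y - k • g`, the loop type, and the defect in its distance determine `(y, k)`.
  have hcard : hSfin.toFinset.card * (m + 1) ≤ hBfin.toFinset.card * (T.card * (D + 1)) := by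
    rw [← Finset.card_range (m + 1), ← Finset.card_range (D + 1), ← Finset.card_product,
      ← Finset.card_product, ← Finset.card_product]
    refine Finset.card_le_card_of_injOn (fun s => (-(s.2 • (τ s.1).1) +ᵥ s.1, τ s.1,
      n - (H.dist x (-(s.2 • (τ s.1).1) +ᵥ s.1) + s.2 * (τ s.1).2))) ?_ ?_
    · rintro ⟨y, k⟩ hs
      obtain ⟨hy, hk⟩ := Finset.mem_product.mp (Finset.mem_coe.mp hs)
      have hy : H.dist x y = n := by simpa using hy
      have hk : k ≤ m := Nat.lt_succ_iff.mp (Finset.mem_range.mp hk)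
      have h1 := (hτ y hy).2 k hk
      have h2 := hlow y hy k
      refine Finset.mem_coe.mpr (Finset.mem_product.mpr ⟨?_, Finset.mem_product.mpr
        ⟨(hτ y hy).1, Finset.mem_range.mpr ?_⟩⟩)
      · rw [Set.Finite.mem_toFinset]
        show H.dist x (-(k • (τ y).1) +ᵥ y) ≤ n
        omega
      · show n - (H.dist x (-(k • (τ y).1) +ᵥ y) + k * (τ y).2) < D + 1
        omega
    · rintro ⟨y, k⟩ hs ⟨y', k'⟩ hs' heq
      obtain ⟨hy, hk⟩ := Finset.mem_product.mp (Finset.mem_coe.mp hs)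
      obtain ⟨hy', hk'⟩ := Finset.mem_product.mp (Finset.mem_coe.mp hs')
      have hy : H.dist x y = n := by simpa using hy
      have hk : k ≤ m := Nat.lt_succ_iff.mp (Finset.mem_range.mp hk)
      have hy' : H.dist x y' = n := by simpa using hy'
      have hk' : k' ≤ m := Nat.lt_succ_iff.mp (Finset.mem_range.mp hk')
      simp only [Prod.mk.injEq] at heq
      obtain ⟨e1, e2, e3⟩ := heq
      have h1 := (hτ y hy).2 k hk
      have h2 := (hτ y' hy').2 k' hk'
      have hl := ((hT _).mp (hτ y hy).1).1
      rw [← e2] at e1 e3 h2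
      rw [← e1] at e3 h2
      have hkk : k = k' := Nat.eq_of_mul_eq_mul_right hl (by omega)
      subst hkk
      exact Prod.ext (by simpa using e1) rfl
  rw [Set.ncard_eq_toFinset_card _ hSfin, Set.ncard_eq_toFinset_card _ hBfin]
  have hn : n ≤ N * T.card * (m + 1) := by
    rw [hm, Nat.div_div_eq_div_mul]
    exact (Nat.lt_mul_div_succ n (Nat.mul_pos hNpos hTpos)).le
  calc n * hSfin.toFinset.card ≤ N * T.card * (m + 1) * hSfin.toFinset.card := by gcongr
    _ = N * T.card * (hSfin.toFinset.card * (m + 1)) := by ring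
    _ ≤ N * T.card * (hBfin.toFinset.card * (T.card * (D + 1))) := by gcongr
    _ = N * T.card * (T.card * (D + 1)) * hBfin.toFinset.card := by ring

theorem tendsto_ncard_ball_ratio [Infinite V] (h : H.IsPeriodic A) (x : V) :
    Filter.Tendsto (fun n : ℕ => ({y | H.dist x y ≤ n + 1}.ncard : ℝ) /
      ({y | H.dist x y ≤ n}.ncard : ℝ)) Filter.atTop (nhds 1) := by
  obtain ⟨C, hC⟩ := h.exists_mul_ncard_sphere_le x
  have hfin (n : ℕ) := h.connected.finite_setOf_dist_le h.finite_neighborSet x n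
  have hpos (n : ℕ) : (0 : ℝ) < {y | H.dist x y ≤ n}.ncard := by
    exact_mod_cast (Set.ncard_pos (hfin n)).mpr ⟨x, by simp⟩
  have hsplit (n : ℕ) : {y | H.dist x y ≤ n + 1}.ncard =
      {y | H.dist x y ≤ n}.ncard + {y | H.dist x y = n + 1}.ncard := by
    have hfinS : {y | H.dist x y = n + 1}.Finite := (hfin (n + 1)).subset fun y hy => le_of_eq hy
    rw [← Set.ncard_union_eq _ (hfin n) hfinS]
    · congr 1
      ext y
      simp [Nat.le_succ_iff]
    · exact Set.disjoint_left.mpr fun y hy hy' => by simp at hy hy'; omega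
  -- The inverse ratio lies between `1 - C / (n + 1)` and `1`.
  have hinv : Filter.Tendsto (fun n : ℕ => ({y | H.dist x y ≤ n}.ncard : ℝ) /
      ({y | H.dist x y ≤ n + 1}.ncard : ℝ)) Filter.atTop (nhds 1) := by
    have hlim : Filter.Tendsto (fun n : ℕ => 1 - (C : ℝ) * (1 / ((n : ℝ) + 1)))
        Filter.atTop (nhds 1) := by
      simpa using (tendsto_one_div_add_atTop_nhds_zero_nat (𝕜 := ℝ)).const_mul (C : ℝ)
        |>.const_sub 1
    refine tendsto_of_tendsto_of_tendsto_of_le_of_le hlim tendsto_const_nhds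
      (fun n => ?_) fun n => ?_
    · have h1 : ((n : ℝ) + 1) * {y | H.dist x y = n + 1}.ncard ≤
          C * {y | H.dist x y ≤ n + 1}.ncard := by exact_mod_cast hC (n + 1)
      have h2 : ({y | H.dist x y ≤ n + 1}.ncard : ℝ) =
          {y | H.dist x y ≤ n}.ncard + {y | H.dist x y = n + 1}.ncard := by
        exact_mod_cast hsplit n
      have h3 := hpos (n + 1)
      have h4 : (0 : ℝ) < n + 1 := by positivity
      show 1 - (C : ℝ) * (1 / ((n : ℝ) + 1)) ≤ _
      rw [le_div_iff₀ h3, sub_mul, one_mul, mul_one_div, sub_le_iff_le_add, div_mul_eq_mul_div,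
        h2, add_le_add_iff_left, le_div_iff₀ h4, ← h2]
      linarith
    · refine div_le_one_of_le₀ ?_ (hpos (n + 1)).le
      exact Nat.cast_le.mpr ((Nat.le_add_right _ _).trans (hsplit n).ge)
  simpa using hinv.inv₀ one_ne_zero

end IsPeriodic

end SimpleGraph

/-! ### Multigraphs with a free cofinite action -/

/-- Since the action is free on vertices, at most two translates of an edge are incident to a given
vertex; hence finitely many edge orbits leave only finitely many neighbours. -/
theorem IsFreeCofiniteAction.finite_neighborSet {d : ℕ} {α β : Type*} {G : Graph α β}
    [AddAction (Fin d → ℤ) G.vertexSet] [AddAction (Fin d → ℤ) G.edgeSet]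
    (hG : IsFreeCofiniteAction d G) (x : G.vertexSet) :
    (G.toSimpleGraph.neighborSet x).Finite := by
  have := hG.finite_edges
  have hinj (u : G.vertexSet) : Function.Injective fun a : Fin d → ℤ => a +ᵥ u :=
    AddAction.vadd_left_injective_of_free hG.free u
  have hpair (u v : G.vertexSet) :
      {y | ∃ a : Fin d → ℤ, a +ᵥ u = x ∧ a +ᵥ v = y}.Finite := by
    refine Set.Subsingleton.finite ?_
    rintro _ ⟨a, ha, rfl⟩ _ ⟨b, hb, rfl⟩
    rw [hinj u (ha.trans hb.symm)]
  -- For each edge `e`, the neighbours of `x` along translates of `e`.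
  have hedge (e : G.edgeSet) :
      {y : G.vertexSet | ∃ a : Fin d → ℤ, G.IsLink ((a +ᵥ e : G.edgeSet) : β) x y}.Finite := by
    obtain ⟨u, v, huv⟩ := (G.edge_mem_iff_exists_isLink e).mp e.2
    let u' : G.vertexSet := ⟨u, huv.left_mem⟩
    let v' : G.vertexSet := ⟨v, huv.right_mem⟩
    refine ((hpair u' v').union (hpair v' u')).subset ?_
    rintro y ⟨a, ha⟩
    have h1 := hG.isLink_vadd a e u' v' huv
    rcases h1.eq_and_eq_or_eq_and_eq ha with ⟨h2, h3⟩ | ⟨h2, h3⟩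
    · exact Or.inl ⟨a, Subtype.ext h2, Subtype.ext h3⟩
    · exact Or.inr ⟨a, Subtype.ext h3, Subtype.ext h2⟩
  refine (Set.finite_iUnion fun q : AddAction.orbitRel.Quotient (Fin d → ℤ) G.edgeSet =>
    hedge (Quotient.out q)).subset ?_
  rintro y ⟨-, e, he⟩
  obtain ⟨q, a, ha⟩ := AddAction.exists_eq_vadd_out (Fin d → ℤ) (⟨e, he.edge_mem⟩ : G.edgeSet)
  refine Set.mem_iUnion.mpr ⟨q, a, ?_⟩
  rwa [← ha]

theorem IsFreeCofiniteAction.isPeriodic {d : ℕ} {α β : Type*} {G : Graph α β}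
    [AddAction (Fin d → ℤ) G.vertexSet] [AddAction (Fin d → ℤ) G.edgeSet]
    (hG : IsFreeCofiniteAction d G) (hconn : G.toSimpleGraph.Connected) :
    G.toSimpleGraph.IsPeriodic (Fin d → ℤ) where
  connected := hconn
  adj_vadd a x y := by
    rintro ⟨hne, e, he⟩
    exact ⟨fun heq => hne (AddAction.injective a heq), _,
      hG.isLink_vadd a ⟨e, he.edge_mem⟩ x y he⟩
  free := hG.free
  finite_orbits := hG.finite_vertices
  finite_neighborSet := hG.finite_neighborSet

theorem mainTheorem6 (d : ℕ) (hd : 1 ≤ d) {α β : Type*} (G : Graph α β)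
    [AddAction (Fin d → ℤ) G.vertexSet] [AddAction (Fin d → ℤ) G.edgeSet]
    (hG : IsFreeCofiniteAction d G) (hconn : G.toSimpleGraph.Connected) :
    @HasPropertyC G.vertexSet hconn.pathMetricSpace := by
  have hP := hG.isPeriodic hconn
  have : Nonempty G.vertexSet := hconn.nonempty
  have : Nonempty (Fin d) := ⟨⟨0, hd⟩⟩
  have hinf : Infinite G.vertexSet :=
    Infinite.of_injective _ (hP.vadd_left_injective (Classical.arbitrary G.vertexSet))
  let _ := hconn.pathMetricSpace
  have hdist (x y : G.vertexSet) : dist x y = (G.toSimpleGraph.dist y x : ℝ) := by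
    rw [SimpleGraph.dist_comm]; rfl
  have hball (x : G.vertexSet) (n : ℕ) :
      Metric.closedBall x (n : ℝ) = {y | G.toSimpleGraph.dist x y ≤ n} := by
    ext y
    simp [hdist]
  have hfin := hconn.finite_setOf_dist_le hP.finite_neighborSet
  refine ⟨?_, hinf, fun x R => ?_, fun x => ⟨fun k => k, Nat.strictMono_cast, ?_, ?_⟩⟩
  · let x := Classical.arbitrary G.vertexSet
    refine Set.countable_univ_iff.mp ((Set.countable_iUnion fun n => (hfin x n).countable).mono
      fun y _ => Set.mem_iUnion.mpr ⟨G.toSimpleGraph.dist x y, le_refl (G.toSimpleGraph.dist x y)⟩)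
  · obtain ⟨n, hn⟩ := exists_nat_ge R
    refine (hfin x n).subset ?_
    rw [← hball]
    exact Metric.closedBall_subset_closedBall hn
  · ext r
    constructor
    · rintro ⟨n, rfl⟩
      obtain ⟨y, hy⟩ := hconn.exists_dist_eq hP.finite_neighborSet x n
      exact ⟨y, by simp [hdist, hy]⟩
    · rintro ⟨y, rfl⟩
      exact ⟨G.toSimpleGraph.dist x y, (hdist y x).symm⟩
  · simpa only [hball] using hP.tendsto_ncard_ball_ratio x
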